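/- \textbf{Theorem (optimality of contests).} There are $k$ identical items and $n>k$ agents. Agent $i$ has a private type $\theta_i$, drawn independently of the others from a distribution $F_i$ with a density that is positive on $\Theta_i=[\underline\theta_i,\bar\theta_i]\subset\mathbb{R}_+$, $\underline\theta_i<\bar\theta_i$. An allocation is an element of $X=\{x\in[0,1]^n:\sum_i x_i\le k\}$. Type $\theta_i$ can generate any signal $s_i\in\mathbb{R}_+$ with effort $e(s_i,\theta_i)=\max\{0,s_i-\theta_i\}$, and gets utility $x_i-\eta\,e(s_i,\theta_i)$ when he receives an item with probability $x_i$; here $\eta>0$. All functions are measurable. An \emph{interim allocation--utility pair} $(\boldsymbol Q,\boldsymbol U)$ consists of functions $Q_i,U_i:\Theta_i\to\mathbb{R}$, $i=1,\dots,n$. The pair is \emph{implementable by a general mechanism} if there are a signal recommendation policy $\tilde s:\prod_j\Theta_j\to\Delta(\mathbb{R}_+^n)$ and an allocation rule $p:\prod_j\Theta_j\times\mathbb{R}_+^n\to X$ such that for all $i$ and $\theta_i,\theta_i'\in\Theta_i$ the expected effort below is finite and $$Q_i(\theta_i)=\mathbf{E}_{\theta_{-i}}\mathbf{E}_{s\sim\tilde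 s(\theta_i,\theta_{-i})}[p_i(\theta_i,\theta_{-i},s)],\qquad U_i(\theta_i)=Q_i(\theta_i)-\eta\,\mathbf{E}_{\theta_{-i}}\mathbf{E}_{s\sim\tilde s(\theta_i,\theta_{-i})}[e(s_i,\theta_i)],$$ $$U_i(\theta_i)\ \ge\ \mathbf{E}_{\theta_{-i}}\mathbf{E}_{s\sim\tilde s(\theta_i',\theta_{-i})}\bigl[\max\{0,\;p_i(\theta_i',\theta_{-i},s)-\eta\,e(s_i,\theta_i)\}\bigr].$$ The pair is \emph{implementable by a contest} if there are a contest rule $x:\mathbb{R}_+^n\to X$ and signal strategies $\hat s_i:\Theta_i\to\mathbb{R}_+$ such that for all $i$, $\theta_i\in\Theta_i$ and $s_i'\in\mathbb{R}_+$ $$Q_i(\theta_i)=\mathbf{E}_{\theta_{-i}}[x_i(\hat s_i(\theta_i),\hat s_{-i}(\theta_{-i}))],\qquad U_i(\theta_i)=Q_i(\theta_i)-\eta\,e(\hat s_i(\theta_i),\theta_i),$$ $$U_i(\theta_i)\ \ge\ \mathbf{E}_{\theta_{-i}}[x_i(s_i',\hat s_{-i}(\theta_{-i}))]-\eta\,e(s_i',\theta_i).$$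 Let $(\boldsymbol Q,\boldsymbol U)$ be implementable by a general mechanism. Then there is a pair $(\boldsymbol Q^\dagger,\boldsymbol U^\dagger)$ that is implementable by a contest, with every $Q_i^\dagger$ nondecreasing on $\Theta_i$, such that $$\mathbf{E}_\theta\Bigl[\sum_i\theta_iQ_i^\dagger(\theta_i)\Bigr]\ \ge\ \mathbf{E}_\theta\Bigl[\sum_i\theta_iQ_i(\theta_i)\Bigr],\qquad U_i^\dagger(\theta_i)\ge U_i(\theta_i)\quad\text{for all } i \text{ and } \theta_i\in\Theta_i,$$ and consequently, for every $\alpha\in[0,1]$, $\mathrm{Obj}_\alpha(\boldsymbol Q^\dagger,\boldsymbol U^\dagger)\ge\mathrm{Obj}_\alpha(\boldsymbol Q,\boldsymbol U)$, where $\mathrm{Obj}_\alpha(\boldsymbol Q,\boldsymbol U)=\mathbf{E}_\theta\bigl[\alpha\sum_i\theta_iQ_i(\theta_i)+(1-\alpha)\sum_iU_i(\theta_i)\bigr]$. -/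

import Mathlib

open MeasureTheory ProbabilityTheory Set
open scoped NNReal ENNReal

noncomputable section

/-- The primitives of the model: `k` identical items, `n > k` agents with independent private
types, agent `i`'s type having a density that is positive on the interval `[lo i, hi i]` of
nonnegative reals, and a marginal cost of effort `η > 0`. -/
structure ContestModel (n : ℕ) where
  /-- number of identical items -/
  k : ℕ
  k_lt_n : k < n
  /-- marginal cost of effort -/
  η : ℝ
  η_pos : 0 < η
  /-- lowest type of each agent -/
  lo : Fin n → ℝ
  /-- highest type of each agent -/
  hi : Fin n → ℝ
  lo_nonneg : ∀ i, 0 ≤ lo i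
  lo_lt_hi : ∀ i, lo i < hi i
  /-- density of the type distribution of each agent -/
  density : Fin n → ℝ → ℝ
  measurable_density : ∀ i, Measurable (density i)
  density_pos : ∀ i, ∀ t ∈ Icc (lo i) (hi i), 0 < density i t
  lintegral_density : ∀ i, ∫⁻ t in Icc (lo i) (hi i), ENNReal.ofReal (density i t) = 1

namespace ContestModel

variable {n : ℕ} (M : ContestModel n)

/-- The type space `Θ i = [lo i, hi i]` of agent `i`. -/
def typeSpace (i : Fin n) : Set ℝ := Icc (M.lo i) (M.hi i)

/-- The distribution `F i` of agent `i`'s type, as a measure on `ℝ` carried by `Θ i`. -/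
def typeDist (i : Fin n) : Measure ℝ :=
  (volume.restrict (M.typeSpace i)).withDensity (fun t => ENNReal.ofReal (M.density i t))

instance (i : Fin n) : IsProbabilityMeasure (M.typeDist i) :=
  ⟨by rw [typeDist, withDensity_apply _ MeasurableSet.univ, Measure.restrict_univ]
      exact M.lintegral_density i⟩

/-- The joint distribution of the (independent) types. An expectation over `θ₋ᵢ` with agent `i`'s
type fixed to `t` is written as an integral against this measure of a function of
`Function.update θ i t`. -/
def profileDist : Measure (Fin n → ℝ) := Measure.pi M.typeDist

/-- The set `X` of (randomized) allocations: agent `i` gets an item with probability `x i`. -/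
def allocations : Set (Fin n → ℝ) :=
  {x | (∀ i, 0 ≤ x i ∧ x i ≤ 1) ∧ ∑ i, x i ≤ (M.k : ℝ)}

/-- The effort `(s - t)⁺` needed by type `t` to generate the signal `s`. -/
def effort (s : ℝ≥0) (t : ℝ) : ℝ := max 0 ((s : ℝ) - t)

/-- `(Q, U)` is implementable by a general mechanism. The signal recommendation policy `σ` draws
a profile of signals from a distribution that may depend on the whole report profile, and the
allocation `p` depends on the report profile and on the signal profile. Policies, allocations and
interim rules are functions on `ℝ`-valued profiles; only their values on types matter. -/
def ImplementableByGeneral (Q U : Fin n → ℝ → ℝ) : Prop :=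
  ∃ (σ : Kernel (Fin n → ℝ) (Fin n → ℝ≥0))
    (p : (Fin n → ℝ) → (Fin n → ℝ≥0) → (Fin n → ℝ)),
    IsMarkovKernel σ ∧
    Measurable (fun z : (Fin n → ℝ) × (Fin n → ℝ≥0) => p z.1 z.2) ∧
    (∀ θ s, p θ s ∈ M.allocations) ∧
    -- consistency of the interim allocation
    (∀ i, ∀ t ∈ M.typeSpace i,
      Q i t = ∫ θ, ∫ s, p (Function.update θ i t) s i ∂(σ (Function.update θ i t))
        ∂M.profileDist) ∧
    -- consistency of the interim utility; the expected effort is finite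
    (∀ i, ∀ t ∈ M.typeSpace i,
      ∫⁻ θ, ∫⁻ s, ENNReal.ofReal (effort (s i) t) ∂(σ (Function.update θ i t))
          ∂M.profileDist ≠ ⊤ ∧
      U i t = Q i t - M.η *
        (∫⁻ θ, ∫⁻ s, ENNReal.ofReal (effort (s i) t) ∂(σ (Function.update θ i t))
          ∂M.profileDist).toReal) ∧
    -- incentives: no gain from misreporting `t'` and then following the recommendation or not
    (∀ i, ∀ t ∈ M.typeSpace i, ∀ t' ∈ M.typeSpace i,
      ∫ θ, ∫ s, max 0 (p (Function.update θ i t') s i - M.η * effort (s i) t)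
          ∂(σ (Function.update θ i t')) ∂M.profileDist ≤ U i t)

/-- `(Q, U)` is implementable by a contest: there are a contest rule `x`, mapping signal profiles
to allocations, and signal strategies `σ i`, depending on agent `i`'s own type only, that induce
`(Q, U)` and form an equilibrium. -/
def ImplementableByContest (Q U : Fin n → ℝ → ℝ) : Prop :=
  ∃ (x : (Fin n → ℝ≥0) → (Fin n → ℝ)) (σ : Fin n → ℝ → ℝ≥0),
    Measurable x ∧
    (∀ s, x s ∈ M.allocations) ∧
    (∀ i, Measurable (σ i)) ∧
    -- consistency
    (∀ i, ∀ t ∈ M.typeSpace i,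
      Q i t = ∫ θ, x (Function.update (fun j => σ j (θ j)) i (σ i t)) i ∂M.profileDist) ∧
    (∀ i, ∀ t ∈ M.typeSpace i, U i t = Q i t - M.η * effort (σ i t) t) ∧
    -- incentives
    (∀ i, ∀ t ∈ M.typeSpace i, ∀ s' : ℝ≥0,
      ∫ θ, x (Function.update (fun j => σ j (θ j)) i s') i ∂M.profileDist
        - M.η * effort s' t ≤ U i t)

/-- Expected matching efficiency of an interim allocation. -/
def matchingEfficiency (Q : Fin n → ℝ → ℝ) : ℝ :=
  ∫ θ, ∑ i, θ i * Q i (θ i) ∂M.profileDist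

/-- The principal's objective with weight `α` on matching efficiency. -/
def objective (α : ℝ) (Q U : Fin n → ℝ → ℝ) : ℝ :=
  ∫ θ, (α * ∑ i, θ i * Q i (θ i) + (1 - α) * ∑ i, U i (θ i)) ∂M.profileDist

end ContestModel

end

/-!
Only the interim quantities of a general mechanism matter: averaging the allocation over the
signals gives a reduced-form rule `P` with interim allocations `Q`, and the incentive constraints
make `U` nondecreasing and `η`-Lipschitz with `U ≤ Q`. Let `R i` be the nondecreasing rearrangement
of `Q i`, that is, the nondecreasing function of the type with the same law. It is more efficient by
the rearrangement inequality, and `U i ≤ R i` because `U i` is nondecreasing. Hence `U i` lies below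
the largest nondecreasing `η`-Lipschitz minorant `V i` of `R i`.

A contest implements `(R, V)`. Type `t` sends the signal `t + (R i t - V i t) / η`, at which `V i`
takes the value `R i t`. The contest thus reads the profile of interim allocations off the signals,
draws a type profile conditionally on the values so revealed, and allocates according to `P` at that
type profile. This gives almost every value its own interim probability. A change of the rule on a
null set extends this to every feasible value, so that sending the signal `s` wins with probability
at most `V i s`, and the Lipschitz property of `V i` rules out profitable deviations.
-/

lemma max_zero_sub_le_add {α : Type*} [AddCommGroup α] [LinearOrder α] [IsOrderedAddMonoid α]
    (a b c : α) : max 0 (a - c) ≤ max 0 (a - b) + max 0 (b - c) :=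
  max_le (add_nonneg (le_max_left _ _) (le_max_left _ _)) <|
    calc a - c = (a - b) + (b - c) := (sub_add_sub_cancel a b c).symm
      _ ≤ max 0 (a - b) + max 0 (b - c) := add_le_add (le_max_right _ _) (le_max_right _ _)

section MonotoneTransport

variable {μ : Measure ℝ}

lemma exists_measure_Iic_eq [IsProbabilityMeasure μ] [NullSingletonClass μ] {c : ℝ≥0∞}
    (hc0 : 0 < c) (hc1 : c < 1) : ∃ a, μ (Iic a) = c := by
  have hcont : Continuous (cdf μ) := by
    refine continuous_iff_continuousAt.2 fun a => ?_
    have hjump := StieltjesFunction.measure_singleton (cdf μ) a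
    rw [measure_cdf, measure_singleton, eq_comm, ENNReal.ofReal_eq_zero, sub_nonpos] at hjump
    rw [(monotone_cdf μ).continuousAt_iff_leftLim_eq_rightLim, StieltjesFunction.rightLim_eq]
    exact le_antisymm ((monotone_cdf μ).leftLim_le le_rfl) hjump
  have hpos : 0 < c.toReal := ENNReal.toReal_pos hc0.ne' hc1.ne_top
  have hlt : c.toReal < 1 := by simpa using ENNReal.toReal_strict_mono ENNReal.one_ne_top hc1
  obtain ⟨x, hx⟩ := ((tendsto_cdf_atBot μ).eventually (eventually_lt_nhds hpos)).exists
  obtain ⟨y, hy⟩ := ((tendsto_cdf_atTop μ).eventually (eventually_gt_nhds hlt)).exists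
  obtain ⟨a, ha⟩ := mem_range_of_exists_le_of_exists_ge hcont ⟨x, hx.le⟩ ⟨y, hy.le⟩
  exact ⟨a, by rw [← ofReal_cdf, ha, ENNReal.ofReal_toReal hc1.ne_top]⟩

lemma measure_setOf_measure_Iic_lt [IsProbabilityMeasure μ] [NullSingletonClass μ] {c : ℝ≥0∞}
    (hc : c ≤ 1) : μ {t | μ (Iic t) < c} = c := by
  refine le_antisymm ?_ (le_of_forall_lt fun d hd => ?_)
  · rcases hc.eq_or_lt with rfl | hc1
    · exact prob_le_one
    rcases eq_zero_or_pos c with rfl | hc0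
    · simp
    obtain ⟨a, ha⟩ := exists_measure_Iic_eq (μ := μ) hc0 hc1
    refine (measure_mono fun t ht => ?_).trans_eq ha
    exact le_of_not_gt fun hat =>
      (ha ▸ measure_mono (Iic_subset_Iic.2 hat.le) : c ≤ μ (Iic t)).not_gt ht
  · obtain ⟨e, hde, hec⟩ := exists_between hd
    obtain ⟨a, ha⟩ := exists_measure_Iic_eq (μ := μ) (bot_le.trans_lt hde) (hec.trans_le hc)
    refine hde.trans_le (ha ▸ measure_mono fun t ht => ?_)
    exact (measure_mono (Iic_subset_Iic.2 ht)).trans_lt (ha ▸ hec)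

/-- The nondecreasing map that carries an atomless law `μ` to a law `ν` on `[a, b]`, that is, the
quantile function of `ν` composed with the distribution function of `μ`. Restricting the quantiles
to `[a, b]` keeps the supremum from being taken over an unbounded set where `μ (Iic t) = 1`. -/
noncomputable def monotoneTransport (μ ν : Measure ℝ) (a b t : ℝ) : ℝ :=
  sSup {q ∈ Icc a b | ν (Iio q) ≤ μ (Iic t)}

variable {ν : Measure ℝ} {a b : ℝ}

lemma bddAbove_setOf_measure_Iio_le (μ ν : Measure ℝ) (a b t : ℝ) :
    BddAbove {q ∈ Icc a b | ν (Iio q) ≤ μ (Iic t)} :=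
  ⟨b, fun _ hq => hq.1.2⟩

lemma nonempty_setOf_measure_Iio_le (hab : a ≤ b) (hν : ∀ᵐ q ∂ν, q ∈ Icc a b) (t : ℝ) :
    {q ∈ Icc a b | ν (Iio q) ≤ μ (Iic t)}.Nonempty := by
  refine ⟨a, left_mem_Icc.2 hab, ?_⟩
  have hIio : ν (Iio a) = 0 :=
    measure_eq_zero_iff_ae_notMem.2 (hν.mono fun q hq hqa => hq.1.not_gt hqa)
  exact hIio ▸ zero_le

lemma monotoneTransport_mem_Icc (hab : a ≤ b) (hν : ∀ᵐ q ∂ν, q ∈ Icc a b) (t : ℝ) :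
    monotoneTransport μ ν a b t ∈ Icc a b := by
  obtain ⟨q, hq⟩ := nonempty_setOf_measure_Iio_le (μ := μ) hab hν t
  exact ⟨hq.1.1.trans (le_csSup (bddAbove_setOf_measure_Iio_le μ ν a b t) hq),
    csSup_le ⟨q, hq⟩ fun _ hr => hr.1.2⟩

lemma monotone_monotoneTransport (hab : a ≤ b) (hν : ∀ᵐ q ∂ν, q ∈ Icc a b) :
    Monotone (monotoneTransport μ ν a b) := fun s t hst =>
  csSup_le_csSup (bddAbove_setOf_measure_Iio_le μ ν a b t)
    (nonempty_setOf_measure_Iio_le hab hν s) fun _ hq =>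
      ⟨hq.1, hq.2.trans (measure_mono (Iic_subset_Iic.2 hst))⟩

lemma measure_Iio_monotoneTransport_le (hab : a ≤ b) (hν : ∀ᵐ q ∂ν, q ∈ Icc a b) (t : ℝ) :
    ν (Iio (monotoneTransport μ ν a b t)) ≤ μ (Iic t) := by
  obtain ⟨u, hu, hlim, hmem⟩ := exists_seq_tendsto_sSup
    (nonempty_setOf_measure_Iio_le (μ := μ) hab hν t) (bddAbove_setOf_measure_Iio_le μ ν a b t)
  have hcover : Iio (monotoneTransport μ ν a b t) ⊆ ⋃ m, Iio (u m) := fun x hx =>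
    mem_iUnion.2 (hlim.eventually (eventually_gt_nhds hx)).exists
  refine (measure_mono hcover).trans ?_
  rw [Monotone.measure_iUnion fun _ _ hmn => Iio_subset_Iio (hu hmn)]
  exact iSup_le fun m => (hmem m).2

lemma le_monotoneTransport_iff (hab : a ≤ b) (hν : ∀ᵐ q ∂ν, q ∈ Icc a b) {q t : ℝ}
    (hq : q ∈ Icc a b) : q ≤ monotoneTransport μ ν a b t ↔ ν (Iio q) ≤ μ (Iic t) :=
  ⟨fun h => (measure_mono (Iio_subset_Iio h)).trans (measure_Iio_monotoneTransport_le hab hν t),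
    fun h => le_csSup (bddAbove_setOf_measure_Iio_le μ ν a b t) ⟨hq, h⟩⟩

lemma map_monotoneTransport [IsProbabilityMeasure μ] [NullSingletonClass μ]
    [IsProbabilityMeasure ν] (hab : a ≤ b) (hν : ∀ᵐ q ∂ν, q ∈ Icc a b) :
    μ.map (monotoneTransport μ ν a b) = ν := by
  have hm : Measurable (monotoneTransport μ ν a b) := (monotone_monotoneTransport hab hν).measurable
  have hmem := monotoneTransport_mem_Icc (μ := μ) hab hν
  refine Measure.ext_of_Ici _ _ fun q => ?_
  rw [Measure.map_apply hm measurableSet_Ici, ← compl_Iio, preimage_compl,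
    prob_compl_eq_one_sub (hm measurableSet_Iio), prob_compl_eq_one_sub measurableSet_Iio]
  congr 1
  rcases le_or_gt q a with hqa | haq
  · have hpre : monotoneTransport μ ν a b ⁻¹' Iio q = ∅ :=
      eq_empty_of_forall_notMem fun t ht => (hqa.trans (hmem t).1).not_gt ht
    rw [hpre, measure_empty, eq_comm, measure_eq_zero_iff_ae_notMem]
    exact hν.mono fun r hr hrq => (hqa.trans hr.1).not_gt hrq
  rcases le_or_gt q b with hqb | hbq
  · have hpre : monotoneTransport μ ν a b ⁻¹' Iio q = {t | μ (Iic t) < ν (Iio q)} := by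
      ext t
      simpa using (le_monotoneTransport_iff hab hν ⟨haq.le, hqb⟩).not
    rw [hpre, measure_setOf_measure_Iic_lt prob_le_one]
  · have hpre : monotoneTransport μ ν a b ⁻¹' Iio q = univ :=
      eq_univ_of_forall fun t => (hmem t).2.trans_lt hbq
    rw [hpre, measure_univ, eq_comm, ← mem_ae_iff_prob_eq_one measurableSet_Iio]
    exact hν.mono fun r hr => hr.2.trans_lt hbq

/-- At `t`, the law of `f` puts at most the mass `μ (Iic t)` below `U t`, because `U t ≤ f`
beyond `t`. -/
lemma le_monotoneTransport_map {S : Set ℝ} (hS : ∀ᵐ t ∂μ, t ∈ S) {f U : ℝ → ℝ}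
    (hf : Measurable f) (hfab : ∀ t, f t ∈ Icc a b) (hU : MonotoneOn U S)
    (hUf : ∀ t ∈ S, U t ≤ f t) {t : ℝ} (ht : t ∈ S) :
    U t ≤ monotoneTransport μ (μ.map f) a b t := by
  have hab : a ≤ b := (hfab t).1.trans (hfab t).2
  have hν : ∀ᵐ q ∂μ.map f, q ∈ Icc a b :=
    (ae_map_iff hf.aemeasurable measurableSet_Icc).2 (ae_of_all _ hfab)
  rcases le_total (U t) a with hUa | hUa
  · exact hUa.trans (monotoneTransport_mem_Icc hab hν t).1
  · rw [le_monotoneTransport_iff hab hν ⟨hUa, (hUf t ht).trans (hfab t).2⟩,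
      Measure.map_apply hf measurableSet_Iio]
    refine measure_mono_ae (hS.mono fun s hs (hlt : f s < U t) => ?_)
    exact le_of_not_gt fun hts => ((hU ht hs hts.le).trans (hUf s hs)).not_gt hlt

end MonotoneTransport

section RearrangementInequality

/-- The convex conjugate of `φ` restricted to `S`. -/
noncomputable def conjugateOn (S : Set ℝ) (φ : ℝ → ℝ) (q : ℝ) : ℝ :=
  ⨆ t : S, (t * q - φ t)

variable {S : Set ℝ} {φ : ℝ → ℝ}

lemma bddAbove_conjugateOn (hS : IsCompact S) (hφ : ContinuousOn φ S) (q : ℝ) :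
    BddAbove (range fun t : S => (t : ℝ) * q - φ t) := by
  have := isCompact_iff_compactSpace.1 hS
  have hφS : Continuous fun t : S => φ t := continuousOn_iff_continuous_domRestrict.1 hφ
  exact (isCompact_range ((continuous_subtype_val.mul_const q).sub hφS)).bddAbove

lemma measurable_conjugateOn (hS : IsCompact S) (hφ : ContinuousOn φ S) :
    Measurable (conjugateOn S φ) :=
  (lowerSemicontinuous_ciSup (bddAbove_conjugateOn hS hφ) fun t =>
    (show Continuous fun q : ℝ => (t : ℝ) * q - φ t by fun_prop).lowerSemicontinuous).measurable

lemma mul_le_add_conjugateOn (hS : IsCompact S) (hφ : ContinuousOn φ S) {t : ℝ} (ht : t ∈ S)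
    (q : ℝ) : t * q ≤ φ t + conjugateOn S φ q :=
  sub_le_iff_le_add'.1 (le_ciSup (bddAbove_conjugateOn hS hφ q) (⟨t, ht⟩ : S))

lemma add_conjugateOn_eq_mul (hS : IsCompact S) (hφ : ContinuousOn φ S) {t q : ℝ} (ht : t ∈ S)
    (hq : ∀ s ∈ S, q * (s - t) ≤ φ s - φ t) : φ t + conjugateOn S φ q = t * q := by
  refine le_antisymm (le_sub_iff_add_le'.1 ?_) (mul_le_add_conjugateOn hS hφ ht q)
  have : Nonempty S := ⟨t, ht⟩
  exact ciSup_le fun s => by linarith [hq s s.2]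

lemma mul_sub_le_intervalIntegral_of_monotone {R : ℝ → ℝ} (hR : Monotone R) (x y : ℝ) :
    R x * (y - x) ≤ ∫ s in x..y, R s := by
  rcases le_total x y with hxy | hyx
  · calc R x * (y - x) = ∫ _ in x..y, R x := by simp [mul_comm]
      _ ≤ ∫ s in x..y, R s := intervalIntegral.integral_mono_on hxy (by simp)
          hR.intervalIntegrable fun s hs => hR hs.1
  · have hle : ∫ s in y..x, R s ≤ ∫ _ in y..x, R x :=
      intervalIntegral.integral_mono_on hyx hR.intervalIntegrable (by simp) fun s hs => hR hs.2
    rw [intervalIntegral.integral_const, smul_eq_mul] at hle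
    rw [intervalIntegral.integral_symm]
    linarith

/-- With `φ` a primitive of `R`, Young's inequality `t q ≤ φ t + φ* q` is an equality at
`q = R t`, and the expectation of the right-hand side depends on `Q` only through its law. -/
theorem integral_mul_le_integral_mul_comp_of_monotone {Ω : Type*} {mΩ : MeasurableSpace Ω}
    {μ : Measure Ω} [IsFiniteMeasure μ] {T Q : Ω → ℝ} {R : ℝ → ℝ} {a b : ℝ}
    (hT : AEMeasurable T μ) (hTab : ∀ᵐ ω ∂μ, T ω ∈ Icc a b) (hR : Monotone R)
    (hQR : IdentDistrib Q (R ∘ T) μ μ) :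
    ∫ ω, T ω * Q ω ∂μ ≤ ∫ ω, T ω * R (T ω) ∂μ := by
  let φ : ℝ → ℝ := fun t => ∫ s in a..t, R s
  have hR_int : ∀ x y, IntervalIntegrable R volume x y := fun _ _ => hR.intervalIntegrable
  have hφ : Continuous φ := intervalIntegral.continuous_primitive hR_int a
  have hφS : ContinuousOn φ (Icc a b) := hφ.continuousOn
  have hsub : ∀ s t, R t * (s - t) ≤ φ s - φ t := fun s t => by
    rw [intervalIntegral.integral_interval_sub_left (hR_int _ _) (hR_int _ _)]
    exact mul_sub_le_intervalIntegral_of_monotone hR t s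
  have hQ_int : Integrable Q μ := hQR.integrable_iff.2 <|
    Integrable.of_mem_Icc (R a) (R b) (hR.measurable.comp_aemeasurable hT)
      (hTab.mono fun ω hω => ⟨hR hω.1, hR hω.2⟩)
  have hT_bdd : ∀ᵐ ω ∂μ, ‖T ω‖ ≤ max |a| |b| :=
    hTab.mono fun ω hω => abs_le_max_abs_abs hω.1 hω.2
  have hTR_int : Integrable (fun ω => T ω * R (T ω)) μ :=
    (hQR.integrable_iff.1 hQ_int).bdd_mul hT.aestronglyMeasurable hT_bdd
  have hφ_int : Integrable (fun ω => φ (T ω)) μ := by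
    obtain ⟨C, hC⟩ := isCompact_Icc.exists_bound_of_continuousOn hφS
    exact .of_bound (hφ.measurable.comp_aemeasurable hT).aestronglyMeasurable C
      (hTab.mono fun ω hω => hC _ hω)
  have hψ : IdentDistrib (conjugateOn (Icc a b) φ ∘ Q) (conjugateOn (Icc a b) φ ∘ R ∘ T) μ μ :=
    hQR.comp (measurable_conjugateOn isCompact_Icc hφS)
  have hYoung_eq : (fun ω => φ (T ω) + conjugateOn (Icc a b) φ (R (T ω)))
      =ᵐ[μ] fun ω => T ω * R (T ω) := hTab.mono fun ω hω =>
    add_conjugateOn_eq_mul isCompact_Icc hφS hω fun s _ => hsub s (T ω)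
  have hψR_int : Integrable (conjugateOn (Icc a b) φ ∘ R ∘ T) μ :=
    (integrable_add_iff_integrable_right hφ_int).1 (hTR_int.congr hYoung_eq.symm)
  have hψQ_int := hψ.integrable_iff.2 hψR_int
  calc ∫ ω, T ω * Q ω ∂μ ≤ ∫ ω, (φ (T ω) + (conjugateOn (Icc a b) φ ∘ Q) ω) ∂μ :=
        integral_mono_ae (hQ_int.bdd_mul hT.aestronglyMeasurable hT_bdd) (hφ_int.add hψQ_int)
          (hTab.mono fun ω hω => mul_le_add_conjugateOn isCompact_Icc hφS hω (Q ω))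
    _ = ∫ ω, (φ (T ω) + (conjugateOn (Icc a b) φ ∘ R ∘ T) ω) ∂μ := by
        rw [integral_add hφ_int hψQ_int, integral_add hφ_int hψR_int, hψ.integral_eq]
    _ = ∫ ω, T ω * R (T ω) ∂μ := integral_congr_ae hYoung_eq

end RearrangementInequality

section LipschitzMinorant

/-- The largest function `V` below `R` on `S` such that `V s ≤ V t + η * max 0 (s - t)` for all
`s` and `t`; in particular `V` is nondecreasing and `η`-Lipschitz. -/
noncomputable def lipschitzMinorant (η : ℝ) (S : Set ℝ) (R : ℝ → ℝ) (s : ℝ) : ℝ :=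
  ⨅ t : S, (R t + η * max 0 (s - t))

variable {η : ℝ} {S : Set ℝ} {R : ℝ → ℝ}

lemma bddBelow_lipschitzMinorant (hη : 0 ≤ η) (hR : BddBelow (R '' S)) (s : ℝ) :
    BddBelow (range fun t : S => R t + η * max 0 (s - t)) := by
  obtain ⟨m, hm⟩ := hR
  refine ⟨m, ?_⟩
  rintro _ ⟨t, rfl⟩
  exact le_add_of_le_of_nonneg (hm (mem_image_of_mem R t.2)) (by positivity)

lemma lipschitzMinorant_le (hη : 0 ≤ η) (hR : BddBelow (R '' S)) {t : ℝ} (ht : t ∈ S) :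
    lipschitzMinorant η S R t ≤ R t := by
  simpa [lipschitzMinorant] using ciInf_le (bddBelow_lipschitzMinorant hη hR t) (⟨t, ht⟩ : S)

lemma lipschitzMinorant_le_add (hη : 0 ≤ η) (hR : BddBelow (R '' S)) (hS : S.Nonempty) (s t : ℝ) :
    lipschitzMinorant η S R s ≤ lipschitzMinorant η S R t + η * max 0 (s - t) := by
  have := hS.to_subtype
  rw [← sub_le_iff_le_add]
  refine le_ciInf fun r => sub_le_iff_le_add.2 ?_
  calc lipschitzMinorant η S R s ≤ R r + η * max 0 (s - r) :=
        ciInf_le (bddBelow_lipschitzMinorant hη hR s) r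
    _ ≤ R r + η * (max 0 (s - t) + max 0 (t - r)) := by gcongr; exact max_zero_sub_le_add s t r
    _ = R r + η * max 0 (t - r) + η * max 0 (s - t) := by ring

lemma monotone_lipschitzMinorant (hη : 0 ≤ η) (hR : BddBelow (R '' S)) (hS : S.Nonempty) :
    Monotone (lipschitzMinorant η S R) := fun s t hst => by
  simpa [max_eq_left (sub_nonpos.2 hst)] using lipschitzMinorant_le_add hη hR hS s t

lemma le_lipschitzMinorant {U : ℝ → ℝ} (hUR : ∀ t ∈ S, U t ≤ R t) {s : ℝ}
    (hS : S.Nonempty) (hU : ∀ t ∈ S, U s ≤ U t + η * max 0 (s - t)) :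
    U s ≤ lipschitzMinorant η S R s := by
  have := hS.to_subtype
  exact le_ciInf fun t => (hU t t.2).trans (by gcongr; exact hUR t t.2)

/-- The minorant grows at rate `η` from `t` on until it reaches the value `R t`. -/
lemma lipschitzMinorant_add_div (hη : 0 < η) (hR : BddBelow (R '' S)) (hmono : MonotoneOn R S)
    {t : ℝ} (ht : t ∈ S) :
    lipschitzMinorant η S R (t + (R t - lipschitzMinorant η S R t) / η) = R t := by
  have : Nonempty S := ⟨t, ht⟩
  set d := (R t - lipschitzMinorant η S R t) / η
  have hd0 : 0 ≤ d := div_nonneg (sub_nonneg.2 (lipschitzMinorant_le hη.le hR ht)) hη.le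
  have hηd : η * d = R t - lipschitzMinorant η S R t := mul_div_cancel₀ _ hη.ne'
  refine le_antisymm ?_ (le_ciInf fun r => ?_)
  · have hle := lipschitzMinorant_le_add hη.le hR ⟨t, ht⟩ (t + d) t
    rwa [add_sub_cancel_left, max_eq_right hd0, hηd, add_sub_cancel] at hle
  · rcases le_total t r with htr | hrt
    · exact le_add_of_le_of_nonneg (hmono ht r.2 htr) (by positivity)
    · have hle := ciInf_le (bddBelow_lipschitzMinorant hη.le hR t) r
      calc R t = lipschitzMinorant η S R t + η * d := by rw [hηd]; ring
        _ ≤ R r + η * (t - r) + η * d := by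
            gcongr
            rwa [max_eq_right (sub_nonneg.2 hrt)] at hle
        _ = R r + η * max 0 (t + d - r) := by rw [max_eq_right (by linarith)]; ring

end LipschitzMinorant

section InterimAllocation

variable {ι : Type*} [Fintype ι] [DecidableEq ι] {α : ι → Type*} [∀ i, MeasurableSpace (α i)]
  {μ : ∀ i, Measure (α i)} {P : (∀ i, α i) → ι → ℝ}

lemma measurePreserving_update_prod_pi [∀ i, IsProbabilityMeasure (μ i)] (i : ι) :
    MeasurePreserving (fun z : α i × (∀ j, α j) => Function.update z.2 i z.1)
      ((μ i).prod (Measure.pi μ)) (Measure.pi μ) := by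
  have hm : Measurable fun z : α i × (∀ j, α j) => Function.update z.2 i z.1 :=
    measurable_update'.comp measurable_swap
  refine ⟨hm, (Measure.pi_eq fun s hs => ?_).symm⟩
  have hpre : (fun z : α i × (∀ j, α j) => Function.update z.2 i z.1) ⁻¹' univ.pi s
      = s i ×ˢ univ.pi (Function.update s i univ) := by
    ext ⟨t, θ⟩
    simp only [mem_preimage, mem_univ_pi, mem_prod]
    rw [Function.forall_update_iff θ fun j x => x ∈ s j,
      Function.forall_update_iff s fun j A => θ j ∈ A]
    simp
  rw [Measure.map_apply hm (.univ_pi hs), hpre, Measure.prod_prod, Measure.pi_pi,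
    ← Finset.mul_prod_erase _ _ (Finset.mem_univ i),
    ← Finset.mul_prod_erase _ (fun j => μ j (s j)) (Finset.mem_univ i), Function.update_self,
    measure_univ, one_mul]
  congr 1
  refine Finset.prod_congr rfl fun j hj => ?_
  rw [Function.update_of_ne (Finset.ne_of_mem_erase hj)]

/-- The expected allocation of agent `i` under the allocation rule `P` when his own type is `t` and
the types of the others are drawn independently according to `μ`. -/
noncomputable def interimAllocation (μ : ∀ i, Measure (α i)) (P : (∀ i, α i) → ι → ℝ) (i : ι)
    (t : α i) : ℝ :=
  ∫ θ, P (Function.update θ i t) i ∂Measure.pi μ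

variable [∀ i, IsProbabilityMeasure (μ i)]

lemma measurable_interimAllocation (hP : Measurable P) (i : ι) :
    Measurable (interimAllocation μ P i) := by
  have hPi : Measurable fun z : α i × (∀ j, α j) => P (Function.update z.2 i z.1) i :=
    (measurable_pi_apply i).comp
      (hP.comp (measurePreserving_update_prod_pi (μ := μ) i).measurable)
  exact hPi.stronglyMeasurable.integral_prod_right.measurable

lemma integrable_update_prod_pi (hP : Integrable P (Measure.pi μ)) (i : ι) :
    Integrable (fun z : α i × (∀ j, α j) => P (Function.update z.2 i z.1) i)
      ((μ i).prod (Measure.pi μ)) :=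
  (measurePreserving_update_prod_pi i).integrable_comp_of_integrable (hP.eval i)

lemma integrable_interimAllocation (hP : Integrable P (Measure.pi μ)) (i : ι) :
    Integrable (interimAllocation μ P i) (μ i) :=
  (integrable_update_prod_pi hP i).integral_prod_left

lemma setIntegral_interimAllocation (hP : Integrable P (Measure.pi μ)) (i : ι) {A : Set (α i)}
    (hA : MeasurableSet A) :
    ∫ t in A, interimAllocation μ P i t ∂μ i
      = ∫ θ in Function.eval i ⁻¹' A, P θ i ∂Measure.pi μ := by
  have hmp := measurePreserving_update_prod_pi (μ := μ) i
  have hpre : (fun z : α i × (∀ j, α j) => Function.update z.2 i z.1) ⁻¹'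
      (Function.eval i ⁻¹' A) = A ×ˢ univ := by ext; simp
  calc ∫ t in A, interimAllocation μ P i t ∂μ i
      = ∫ z in A ×ˢ univ, P (Function.update z.2 i z.1) i ∂(μ i).prod (Measure.pi μ) := by
        rw [setIntegral_prod _ (integrable_update_prod_pi hP i).integrableOn]
        simp only [Measure.restrict_univ, interimAllocation]
    _ = ∫ θ in Function.eval i ⁻¹' A, P θ i
          ∂((μ i).prod (Measure.pi μ)).map fun z => Function.update z.2 i z.1 := by
        rw [setIntegral_map (measurable_pi_apply i hA)
          (hmp.map_eq.symm ▸ (hP.eval i).aestronglyMeasurable) hmp.measurable.aemeasurable, hpre]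
    _ = ∫ θ in Function.eval i ⁻¹' A, P θ i ∂Measure.pi μ := by rw [hmp.map_eq]

lemma measurable_interimAllocation_profile (hP : Measurable P) :
    Measurable fun (θ : ∀ i, α i) j => interimAllocation μ P j (θ j) :=
  measurable_pi_lambda _ fun j =>
    (measurable_interimAllocation hP j).comp (measurable_pi_apply j)

lemma pi_map_interimAllocation (hP : Measurable P) :
    (Measure.pi μ).map (fun θ j => interimAllocation μ P j (θ j))
      = Measure.pi fun j => (μ j).map (interimAllocation μ P j) :=
  Measure.pi_map_pi fun j => (measurable_interimAllocation hP j).aemeasurable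

lemma setIntegral_integral_condDistrib_id {Ω β F : Type*} [MeasurableSpace Ω]
    [StandardBorelSpace Ω] [Nonempty Ω] [MeasurableSpace β] [NormedAddCommGroup F]
    [NormedSpace ℝ F] [CompleteSpace F] {μ : Measure Ω} [IsFiniteMeasure μ] {X : Ω → β}
    (hX : Measurable X) {f : Ω → F} (hf : Integrable f μ) {B : Set β} (hB : MeasurableSet B) :
    ∫ ω in X ⁻¹' B, ∫ y, f y ∂condDistrib id X μ (X ω) ∂μ = ∫ ω in X ⁻¹' B, f ω ∂μ := by
  rw [← setIntegral_condExp hX.comap_le hf ⟨B, hB, rfl⟩]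
  exact setIntegral_congr_ae (hX hB)
    ((condExp_ae_eq_integral_condDistrib_id hX hf).mono fun ω hω _ => hω.symm)

section Conditioning

variable [∀ i, StandardBorelSpace (α i)] [∀ i, Nonempty (α i)]

/-- The allocation rule on profiles of interim allocations that is obtained from `P` by drawing
the type profile conditionally on the profile of interim allocations it induces. -/
noncomputable def conditionalAllocation (μ : ∀ i, Measure (α i)) [∀ i, IsProbabilityMeasure (μ i)]
    (P : (∀ i, α i) → ι → ℝ) (q : ι → ℝ) : ι → ℝ :=
  ∫ θ, P θ ∂condDistrib id (fun θ j => interimAllocation μ P j (θ j)) (Measure.pi μ) q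

lemma measurable_conditionalAllocation (hP : Measurable P) :
    Measurable (conditionalAllocation μ P) :=
  hP.stronglyMeasurable.integral_kernel.measurable

lemma integrable_conditionalAllocation (hP : Measurable P) (hPint : Integrable P (Measure.pi μ)) :
    Integrable (conditionalAllocation μ P)
      (Measure.pi fun j => (μ j).map (interimAllocation μ P j)) := by
  have hQ := measurable_interimAllocation_profile (μ := μ) hP
  rw [← pi_map_interimAllocation hP]
  exact (integrable_map_measure (measurable_conditionalAllocation hP).aestronglyMeasurable
    hQ.aemeasurable).2
      (integrable_condExp.congr (condExp_ae_eq_integral_condDistrib_id hQ hPint))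

lemma setIntegral_conditionalAllocation (hP : Measurable P) (hPint : Integrable P (Measure.pi μ))
    (i : ι) {B : Set (ι → ℝ)} (hB : MeasurableSet B) :
    ∫ q in B, conditionalAllocation μ P q i
        ∂(Measure.pi fun j => (μ j).map (interimAllocation μ P j))
      = ∫ θ in (fun θ j => interimAllocation μ P j (θ j)) ⁻¹' B, P θ i ∂Measure.pi μ := by
  have hQ := measurable_interimAllocation_profile (μ := μ) hP
  have hx := integrable_conditionalAllocation hP hPint
  rw [← eval_integral fun j => (hx.eval j).integrableOn,
    ← eval_integral fun j => (hPint.eval j).integrableOn]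
  refine congrFun (?_ : _ = _) i
  rw [← pi_map_interimAllocation hP] at hx ⊢
  rw [setIntegral_map hB hx.aestronglyMeasurable hQ.aemeasurable]
  exact setIntegral_integral_condDistrib_id hQ hPint hB

lemma ae_interimAllocation_conditionalAllocation_eq (hP : Measurable P)
    (hPint : Integrable P (Measure.pi μ)) (i : ι) :
    ∀ᵐ r ∂(μ i).map (interimAllocation μ P i),
      interimAllocation (fun j => (μ j).map (interimAllocation μ P j))
        (conditionalAllocation μ P) i r = r := by
  have hQ := fun j => measurable_interimAllocation (μ := μ) hP j
  have := fun j => Measure.isProbabilityMeasure_map (hQ j).aemeasurable (μ := μ j)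
  have hx := integrable_conditionalAllocation hP hPint
  have hid : Integrable id ((μ i).map (interimAllocation μ P i)) :=
    (integrable_map_measure aestronglyMeasurable_id (hQ i).aemeasurable).2
      (integrable_interimAllocation hPint i)
  refine Integrable.ae_eq_of_forall_setIntegral_eq _ id (integrable_interimAllocation
    (μ := fun j => (μ j).map (interimAllocation μ P j)) hx i) hid fun A hA _ => ?_
  calc ∫ r in A, interimAllocation (fun j => (μ j).map (interimAllocation μ P j))
        (conditionalAllocation μ P) i r ∂(μ i).map (interimAllocation μ P i)
      = ∫ q in Function.eval i ⁻¹' A, conditionalAllocation μ P q i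
          ∂(Measure.pi fun j => (μ j).map (interimAllocation μ P j)) :=
        setIntegral_interimAllocation
          (μ := fun j => (μ j).map (interimAllocation μ P j)) hx i hA
    _ = ∫ θ in Function.eval i ⁻¹' (interimAllocation μ P i ⁻¹' A), P θ i ∂Measure.pi μ :=
        setIntegral_conditionalAllocation hP hPint i (measurable_pi_apply i hA)
    _ = ∫ t in interimAllocation μ P i ⁻¹' A, interimAllocation μ P i t ∂μ i :=
        (setIntegral_interimAllocation hPint i (hQ i hA)).symm
    _ = ∫ r in A, id r ∂(μ i).map (interimAllocation μ P i) :=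
        (setIntegral_map hA aestronglyMeasurable_id (hQ i).aemeasurable).symm

end Conditioning

section Repair

variable {ν : ι → Measure ℝ} {K : Set (ι → ℝ)} {x : (ι → ℝ) → ι → ℝ}

open Classical in
/-- The allocation rule `x`, changed at the profiles with a coordinate `i` at which the interim
allocation is not `q i`: if there is only one such coordinate, then that agent alone receives
`q i`, provided that this is feasible. -/
noncomputable def repairedAllocation (ν : ι → Measure ℝ) (K : Set (ι → ℝ))
    (x : (ι → ℝ) → ι → ℝ) (q : ι → ℝ) : ι → ℝ :=
  if ∀ j, interimAllocation ν x j (q j) = q j then x q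
  else fun i => if (∀ j ≠ i, interimAllocation ν x j (q j) = q j) ∧ Pi.single i (q i) ∈ K
    then q i else 0

lemma repairedAllocation_mem (hK : 0 ∈ K) {q : ι → ℝ} (hx : x q ∈ K) :
    repairedAllocation ν K x q ∈ K := by
  classical
  by_cases hexact : ∀ j, interimAllocation ν x j (q j) = q j
  · rwa [repairedAllocation, if_pos hexact]
  obtain ⟨i, hi⟩ := not_forall.1 hexact
  have hsingle : repairedAllocation ν K x q = Pi.single i (repairedAllocation ν K x q i) := by
    refine Function.eq_update_iff.2 ⟨rfl, fun j hj => ?_⟩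
    rw [Pi.zero_apply, repairedAllocation, if_neg hexact, if_neg fun h => hi (h.1 i hj.symm)]
  rw [hsingle, repairedAllocation, if_neg hexact]
  split_ifs with h
  · exact h.2
  · rwa [Pi.single_zero]

variable [∀ i, IsProbabilityMeasure (ν i)]

lemma measurable_repairedAllocation (hK : MeasurableSet K) (hx : Measurable x) :
    Measurable (repairedAllocation ν K x) := by
  classical
  have hexact : ∀ j, MeasurableSet {q : ι → ℝ | interimAllocation ν x j (q j) = q j} := fun j =>
    measurableSet_eq_fun ((measurable_interimAllocation hx j).comp (measurable_pi_apply j))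
      (measurable_pi_apply j)
  have hsingle : ∀ i, Measurable fun q : ι → ℝ => (Pi.single i (q i) : ι → ℝ) := fun i =>
    (measurable_update 0).comp (measurable_pi_apply i)
  have hall : MeasurableSet {q : ι → ℝ | ∀ j, interimAllocation ν x j (q j) = q j} := by
    simpa only [ofPred_forall] using MeasurableSet.iInter hexact
  have hothers : ∀ i,
      MeasurableSet {q : ι → ℝ | ∀ j ≠ i, interimAllocation ν x j (q j) = q j} := fun i => by
    simpa only [ofPred_forall] using
      MeasurableSet.iInter fun j => MeasurableSet.iInter fun _ : j ≠ i => hexact j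
  exact Measurable.ite hall hx (measurable_pi_lambda _ fun i =>
    Measurable.ite ((hothers i).inter (hsingle i hK)) (measurable_pi_apply i) measurable_const)

lemma interimAllocation_repairedAllocation_eq
    (hx : ∀ i, ∀ᵐ r ∂ν i, interimAllocation ν x i r = r) {i : ι} {r : ℝ}
    (hr : Pi.single i r ∈ K) : interimAllocation ν (repairedAllocation ν K x) i r = r := by
  classical
  have hexact : ∀ᵐ q ∂Measure.pi ν, ∀ j, interimAllocation ν x j (q j) = q j :=
    ae_all_iff.2 fun j => (measurePreserving_eval ν j).quasiMeasurePreserving.ae (hx j)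
  by_cases hri : interimAllocation ν x i r = r
  · refine (integral_congr_ae (hexact.mono fun q hq => ?_)).trans hri
    have hupd : ∀ j, interimAllocation ν x j (Function.update q i r j) = Function.update q i r j :=
      (Function.forall_update_iff q fun j s => interimAllocation ν x j s = s).2
        ⟨hri, fun j _ => hq j⟩
    simp only [repairedAllocation, if_pos hupd]
  · have hconst : ∀ᵐ q ∂Measure.pi ν, repairedAllocation ν K x (Function.update q i r) i = r := by
      refine hexact.mono fun q hq => ?_
      rw [repairedAllocation, if_neg fun h => hri (by simpa using h i), if_pos,
        Function.update_self]
      exact ⟨fun j hj => by simpa [hj] using hq j, by simpa using hr⟩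
    rw [interimAllocation, integral_congr_ae hconst, integral_const, probReal_univ, one_smul]

end Repair

theorem exists_interimAllocation_eq_self [∀ i, StandardBorelSpace (α i)]
    {K : Set (ι → ℝ)} (hK_compact : IsCompact K) (hK_convex : Convex ℝ K) (hK_zero : 0 ∈ K)
    (hP : Measurable P) (hPK : ∀ θ, P θ ∈ K) :
    ∃ y : (ι → ℝ) → ι → ℝ, Measurable y ∧ (∀ q, y q ∈ K) ∧ ∀ i r, Pi.single i r ∈ K →
      interimAllocation (fun j => (μ j).map (interimAllocation μ P j)) y i r = r := by
  have := fun j => nonempty_of_isProbabilityMeasure (μ j)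
  have hP_int : ∀ m : Measure (∀ i, α i), IsProbabilityMeasure m → Integrable P m := fun m _ => by
    obtain ⟨C, hC⟩ := hK_compact.isBounded.exists_norm_le
    exact .of_bound hP.aestronglyMeasurable C (ae_of_all _ fun θ => hC _ (hPK θ))
  have := fun j => Measure.isProbabilityMeasure_map (μ := μ j)
    (measurable_interimAllocation (μ := μ) hP j).aemeasurable
  have hexact := ae_interimAllocation_conditionalAllocation_eq hP
    (hP_int (Measure.pi μ) inferInstance)
  refine ⟨repairedAllocation _ K (conditionalAllocation μ P),
    measurable_repairedAllocation (ν := fun j => (μ j).map (interimAllocation μ P j))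
      hK_compact.measurableSet (measurable_conditionalAllocation hP),
    fun q => repairedAllocation_mem hK_zero ?_,
    fun i r => interimAllocation_repairedAllocation_eq hexact⟩
  exact hK_convex.integral_mem hK_compact.isClosed (ae_of_all _ hPK) (hP_int _ inferInstance)

end InterimAllocation

namespace ContestModel

variable {n : ℕ} (M : ContestModel n)

instance (i : Fin n) : NullSingletonClass (M.typeDist i) := by
  unfold typeDist; infer_instance

instance : IsProbabilityMeasure M.profileDist := by
  unfold profileDist; infer_instance

lemma ae_mem_typeSpace (i : Fin n) : ∀ᵐ t ∂M.typeDist i, t ∈ M.typeSpace i :=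
  (withDensity_absolutelyContinuous _ _).ae_le (ae_restrict_mem measurableSet_Icc)

lemma typeSpace_nonempty (i : Fin n) : (M.typeSpace i).Nonempty :=
  nonempty_Icc.2 (M.lo_lt_hi i).le

/-- The largest probability with which a single agent can receive an item; it is `0` when there are
no items. -/
noncomputable def maxProb : ℝ := min 1 M.k

lemma maxProb_nonneg : 0 ≤ M.maxProb := le_min zero_le_one (Nat.cast_nonneg _)

lemma allocations_eq : M.allocations = Icc 0 1 ∩ {x | ∑ i, x i ≤ (M.k : ℝ)} := by
  ext x
  simp only [allocations, mem_ofPred_eq, mem_inter_iff, mem_Icc, Pi.le_def, forall_and,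
    Pi.zero_apply, Pi.one_apply]

lemma isCompact_allocations : IsCompact M.allocations := by
  rw [allocations_eq]
  exact isCompact_Icc.inter_right (isClosed_le (by fun_prop) continuous_const)

lemma convex_allocations : Convex ℝ M.allocations := by
  rw [allocations_eq]
  refine (convex_Icc 0 1).inter (convex_halfSpace_le ⟨fun x y => ?_, fun c x => ?_⟩ _)
  · exact Finset.sum_add_distrib
  · exact (Finset.mul_sum _ _ _).symm

variable {M}

lemma apply_mem_Icc_of_mem_allocations {x : Fin n → ℝ} (hx : x ∈ M.allocations) (i : Fin n) :
    x i ∈ Icc 0 M.maxProb :=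
  ⟨(hx.1 i).1, le_min (hx.1 i).2
    ((Finset.single_le_sum (fun j _ => (hx.1 j).1) (Finset.mem_univ i)).trans hx.2)⟩

lemma single_mem_allocations {i : Fin n} {r : ℝ} (hr : r ∈ Icc 0 M.maxProb) :
    Pi.single i r ∈ M.allocations := by
  refine ⟨fun j => ?_, ?_⟩
  · rcases eq_or_ne j i with rfl | hj
    · simpa using ⟨hr.1, hr.2.trans (min_le_left _ _)⟩
    · simp [hj]
  · simpa using hr.2.trans (min_le_right _ _)

lemma zero_mem_allocations : 0 ∈ M.allocations :=
  ⟨fun _ => ⟨le_rfl, zero_le_one⟩, by simp⟩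

lemma integrable_of_monotoneOn {i : Fin n} {g : ℝ → ℝ} (hg : MonotoneOn g (M.typeSpace i)) :
    Integrable g (M.typeDist i) := by
  rw [← Measure.restrict_eq_self_of_ae_mem (M.ae_mem_typeSpace i)]
  exact hg.integrableOn_isCompact isCompact_Icc

lemma integrable_of_mem_allocations {Ω : Type*} [MeasurableSpace Ω] {μ : Measure Ω}
    [IsFiniteMeasure μ] {f : Ω → Fin n → ℝ} (hf : Measurable f) (hfX : ∀ ω, f ω ∈ M.allocations) :
    Integrable f μ := by
  obtain ⟨C, hC⟩ := M.isCompact_allocations.isBounded.exists_norm_le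
  exact .of_bound hf.aestronglyMeasurable C (ae_of_all _ fun ω => hC _ (hfX ω))

lemma interimAllocation_mem_Icc {P : (Fin n → ℝ) → Fin n → ℝ} (hP : Measurable P)
    (hPX : ∀ θ, P θ ∈ M.allocations) (i : Fin n) (t : ℝ) :
    interimAllocation M.typeDist P i t ∈ Icc 0 M.maxProb :=
  (convex_Icc 0 M.maxProb).integral_mem isClosed_Icc
    (ae_of_all _ fun _ => apply_mem_Icc_of_mem_allocations (hPX _) i)
    ((integrable_of_mem_allocations (hP.comp measurable_update_left) fun _ => hPX _).eval i)

section Effort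

lemma effort_nonneg (s : ℝ≥0) (t : ℝ) : 0 ≤ effort s t := le_max_left _ _

lemma effort_le_add (s : ℝ≥0) (t t' : ℝ) : effort s t ≤ effort s t' + max 0 (t' - t) :=
  max_zero_sub_le_add _ _ _

lemma measurable_effort (t : ℝ) : Measurable fun s => effort s t := by
  unfold effort; fun_prop

end Effort

section GeneralMechanism

variable {Q U : Fin n → ℝ → ℝ}

variable (M) in
/-- The joint law of the type profile and of the recommended signals when agent `i` reports `t` and
the others report truthfully. -/
noncomputable def outcomeDist (σ : Kernel (Fin n → ℝ) (Fin n → ℝ≥0)) (i : Fin n) (t : ℝ) :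
    Measure ((Fin n → ℝ) × (Fin n → ℝ≥0)) :=
  M.profileDist ⊗ₘ σ.comap (Function.update · i t) measurable_update_left

instance (σ : Kernel (Fin n → ℝ) (Fin n → ℝ≥0)) [IsMarkovKernel σ] (i : Fin n) (t : ℝ) :
    IsProbabilityMeasure (M.outcomeDist σ i t) := by
  unfold outcomeDist; infer_instance

lemma integral_outcomeDist {σ : Kernel (Fin n → ℝ) (Fin n → ℝ≥0)} [IsMarkovKernel σ] {i : Fin n}
    {t : ℝ} {f : (Fin n → ℝ) × (Fin n → ℝ≥0) → ℝ} (hf : Integrable f (M.outcomeDist σ i t)) :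
    ∫ z, f z ∂M.outcomeDist σ i t
      = ∫ θ, ∫ s, f (θ, s) ∂σ (Function.update θ i t) ∂M.profileDist :=
  Measure.integral_compProd hf

lemma lintegral_effort_outcomeDist (σ : Kernel (Fin n → ℝ) (Fin n → ℝ≥0)) [IsMarkovKernel σ]
    (i : Fin n) (t : ℝ) :
    ∫⁻ z, ENNReal.ofReal (effort (z.2 i) t) ∂M.outcomeDist σ i t
      = ∫⁻ θ, ∫⁻ s, ENNReal.ofReal (effort (s i) t) ∂σ (Function.update θ i t) ∂M.profileDist :=
  have hm : Measurable fun z : (Fin n → ℝ) × (Fin n → ℝ≥0) => effort (z.2 i) t :=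
    (measurable_effort t).comp (by fun_prop)
  Measure.lintegral_compProd hm.ennreal_ofReal

lemma integrable_effort_outcomeDist {σ : Kernel (Fin n → ℝ) (Fin n → ℝ≥0)} [IsMarkovKernel σ]
    {i : Fin n} {t : ℝ}
    (hfin : ∫⁻ θ, ∫⁻ s, ENNReal.ofReal (effort (s i) t) ∂σ (Function.update θ i t)
      ∂M.profileDist ≠ ⊤) :
    Integrable (fun z => effort (z.2 i) t) (M.outcomeDist σ i t) := by
  refine ⟨((measurable_effort t).comp (by fun_prop)).aestronglyMeasurable, ?_⟩
  rw [hasFiniteIntegral_iff_ofReal (ae_of_all _ fun z => effort_nonneg _ _),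
    lintegral_effort_outcomeDist]
  exact hfin.lt_top

lemma ImplementableByGeneral.utility_le_add (h : M.ImplementableByGeneral Q U) (i : Fin n) {s t : ℝ}
    (hs : s ∈ M.typeSpace i) (ht : t ∈ M.typeSpace i) :
    U i s ≤ U i t + M.η * max 0 (s - t) := by
  obtain ⟨σ, p, hσ, hp, hpX, hQ, hU, hIC⟩ := h
  let e : ℝ → (Fin n → ℝ) × (Fin n → ℝ≥0) → ℝ := fun r z => effort (z.2 i) r
  let a : (Fin n → ℝ) × (Fin n → ℝ≥0) → ℝ := fun z => p (Function.update z.1 i s) z.2 i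
  have he : ∀ r, Measurable (e r) := fun r => (measurable_effort r).comp (by fun_prop)
  have ha : Measurable a := (measurable_pi_apply i).comp
    (hp.comp ((measurable_update_left.comp measurable_fst).prodMk measurable_snd))
  have ha_mem : ∀ z, a z ∈ Icc 0 1 := fun z => (hpX _ _).1 i
  have ha_int : Integrable a (M.outcomeDist σ i s) :=
    .of_mem_Icc 0 1 ha.aemeasurable (ae_of_all _ ha_mem)
  have he_int : Integrable (e s) (M.outcomeDist σ i s) :=
    integrable_effort_outcomeDist (hU i s hs).1
  have hdev_int : Integrable (fun z => max 0 (a z - M.η * e t z)) (M.outcomeDist σ i s) :=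
    .of_mem_Icc 0 1 (by fun_prop) (ae_of_all _ fun z => ⟨le_max_left _ _, max_le zero_le_one
      ((sub_le_self _ (mul_nonneg M.η_pos.le (effort_nonneg _ _))).trans (ha_mem z).2)⟩)
  calc U i s = ∫ z, (a z - M.η * e s z) ∂M.outcomeDist σ i s := by
        rw [(hU i s hs).2, hQ i s hs, integral_sub ha_int (he_int.const_mul _),
          integral_outcomeDist ha_int, integral_const_mul, integral_eq_lintegral_of_nonneg_ae
            (ae_of_all _ fun z => effort_nonneg _ _) he_int.aestronglyMeasurable,
          lintegral_effort_outcomeDist]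
    _ ≤ ∫ z, (max 0 (a z - M.η * e t z) + M.η * max 0 (s - t)) ∂M.outcomeDist σ i s := by
        refine integral_mono (ha_int.sub (he_int.const_mul _))
          (hdev_int.add (integrable_const _)) fun z => ?_
        have heffort : M.η * e t z ≤ M.η * (e s z + max 0 (s - t)) :=
          mul_le_mul_of_nonneg_left (effort_le_add _ t s) M.η_pos.le
        dsimp only
        linarith [le_max_right 0 (a z - M.η * e t z)]
    _ = ∫ θ, ∫ s', max 0 (a (θ, s') - M.η * e t (θ, s')) ∂σ (Function.update θ i s)
          ∂M.profileDist + M.η * max 0 (s - t) := by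
        rw [integral_add hdev_int (integrable_const _), integral_outcomeDist hdev_int,
          integral_const, probReal_univ, one_smul]
    _ ≤ U i t + M.η * max 0 (s - t) := by gcongr; exact hIC i t ht s hs

lemma ImplementableByGeneral.monotoneOn_utility (h : M.ImplementableByGeneral Q U) (i : Fin n) :
    MonotoneOn (U i) (M.typeSpace i) := fun s hs t ht hst => by
  simpa [max_eq_left (sub_nonpos.2 hst)] using h.utility_le_add i hs ht

lemma ImplementableByGeneral.utility_le_allocation (h : M.ImplementableByGeneral Q U) (i : Fin n)
    {t : ℝ} (ht : t ∈ M.typeSpace i) : U i t ≤ Q i t := by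
  obtain ⟨σ, p, -, -, -, -, hU, -⟩ := h
  rw [(hU i t ht).2]
  exact sub_le_self _ (mul_nonneg M.η_pos.le ENNReal.toReal_nonneg)

lemma ImplementableByGeneral.exists_eq_interimAllocation (h : M.ImplementableByGeneral Q U) :
    ∃ P : (Fin n → ℝ) → Fin n → ℝ, Measurable P ∧ (∀ θ, P θ ∈ M.allocations) ∧
      ∀ i, ∀ t ∈ M.typeSpace i, Q i t = interimAllocation M.typeDist P i t := by
  obtain ⟨σ, p, hσ, hp, hpX, hQ, -, -⟩ := h
  have hint : ∀ θ, Integrable (p θ) (σ θ) := fun θ =>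
    integrable_of_mem_allocations (hp.comp measurable_prodMk_left) (hpX θ)
  refine ⟨fun θ => ∫ s, p θ s ∂σ θ, ?_, fun θ => ?_, fun i t ht => ?_⟩
  · exact (hp.stronglyMeasurable.integral_kernel_prod_right' (κ := σ)).measurable
  · exact M.convex_allocations.integral_mem M.isCompact_allocations.isClosed
      (ae_of_all _ (hpX θ)) (hint θ)
  · simp only [hQ i t ht, interimAllocation, eval_integral fun j => (hint _).eval j, profileDist]

end GeneralMechanism

section Contest

variable {R : Fin n → ℝ → ℝ}

variable (M) in
/-- The equilibrium utilities of the contest that implements the interim allocations `R`. -/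
noncomputable def contestUtility (R : Fin n → ℝ → ℝ) (i : Fin n) : ℝ → ℝ :=
  lipschitzMinorant M.η (M.typeSpace i) (R i)

variable (M) in
/-- The signal whose effort cost is the gap between the interim allocation `R i t` and the utility
of type `t`; it is an honest nonnegative signal only for `t` in the type space. -/
noncomputable def contestSignal (R : Fin n → ℝ → ℝ) (i : Fin n) (t : ℝ) : ℝ≥0 :=
  (t + (R i t - M.contestUtility R i t) / M.η).toNNReal

variable {i : Fin n}

lemma monotone_contestUtility (hR : BddBelow (R i '' M.typeSpace i)) :
    Monotone (M.contestUtility R i) :=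
  monotone_lipschitzMinorant M.η_pos.le hR (M.typeSpace_nonempty i)

lemma integrable_contestUtility (hR : BddBelow (R i '' M.typeSpace i)) :
    Integrable (M.contestUtility R i) (M.typeDist i) :=
  integrable_of_monotoneOn ((monotone_contestUtility hR).monotoneOn _)

lemma contestUtility_nonneg (hR : ∀ t ∈ M.typeSpace i, 0 ≤ R i t) (s : ℝ) :
    0 ≤ M.contestUtility R i s :=
  le_lipschitzMinorant (U := fun _ => 0) hR (M.typeSpace_nonempty i) fun _ _ => by
    rw [zero_add]
    exact mul_nonneg M.η_pos.le (le_max_left _ _)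

lemma measurable_contestSignal (hR : BddBelow (R i '' M.typeSpace i)) (hRm : Measurable (R i)) :
    Measurable (M.contestSignal R i) := by
  have hV := (monotone_contestUtility hR).measurable
  unfold contestSignal
  fun_prop

lemma coe_contestSignal (hR : BddBelow (R i '' M.typeSpace i)) {t : ℝ} (ht : t ∈ M.typeSpace i) :
    (M.contestSignal R i t : ℝ) = t + (R i t - M.contestUtility R i t) / M.η :=
  Real.coe_toNNReal _ (add_nonneg ((M.lo_nonneg i).trans ht.1)
    (div_nonneg (sub_nonneg.2 (lipschitzMinorant_le M.η_pos.le hR ht)) M.η_pos.le))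

lemma contestUtility_contestSignal (hR : BddBelow (R i '' M.typeSpace i))
    (hmono : MonotoneOn (R i) (M.typeSpace i)) {t : ℝ} (ht : t ∈ M.typeSpace i) :
    M.contestUtility R i (M.contestSignal R i t) = R i t := by
  rw [coe_contestSignal hR ht]
  exact lipschitzMinorant_add_div M.η_pos hR hmono ht

lemma mul_effort_contestSignal (hR : BddBelow (R i '' M.typeSpace i)) {t : ℝ}
    (ht : t ∈ M.typeSpace i) :
    M.η * effort (M.contestSignal R i t) t = R i t - M.contestUtility R i t := by
  have hgap : 0 ≤ (R i t - M.contestUtility R i t) / M.η :=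
    div_nonneg (sub_nonneg.2 (lipschitzMinorant_le M.η_pos.le hR ht)) M.η_pos.le
  rw [effort, coe_contestSignal hR ht, add_sub_cancel_left, max_eq_right hgap,
    mul_div_cancel₀ _ M.η_pos.ne']

lemma integral_eq_interimAllocation_of_comp_signal {y : (Fin n → ℝ) → Fin n → ℝ} (hy : Measurable y)
    {g : Fin n → ℝ≥0 → ℝ} {σ : Fin n → ℝ → ℝ≥0} (hR : ∀ j, Measurable (R j))
    (hgσ : ∀ j, ∀ t ∈ M.typeSpace j, g j (σ j t) = R j t) (s : ℝ≥0) :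
    ∫ θ, y (fun j => g j (Function.update (fun j => σ j (θ j)) i s j)) i ∂M.profileDist
      = interimAllocation (fun j => (M.typeDist j).map (R j)) y i (g i s) := by
  have hmem : ∀ᵐ θ ∂M.profileDist, ∀ j, θ j ∈ M.typeSpace j := ae_all_iff.2 fun j =>
    (measurePreserving_eval M.typeDist j).quasiMeasurePreserving.ae (M.ae_mem_typeSpace j)
  have hvalue : ∀ᵐ θ ∂M.profileDist,
      y (fun j => g j (Function.update (fun j => σ j (θ j)) i s j)) i
        = y (Function.update (fun j => R j (θ j)) i (g i s)) i := hmem.mono fun θ hθ => by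
    congr 1
    refine Function.eq_update_iff.2 ⟨by simp, fun j hj => ?_⟩
    rw [Function.update_of_ne hj, hgσ j _ (hθ j)]
  have hRm : Measurable fun (θ : Fin n → ℝ) j => R j (θ j) :=
    measurable_pi_lambda _ fun j => (hR j).comp (measurable_pi_apply j)
  have hyi : Measurable fun q => y (Function.update q i (g i s)) i :=
    (measurable_pi_apply i).comp (hy.comp measurable_update_left)
  rw [integral_congr_ae hvalue, interimAllocation, profileDist,
    ← Measure.pi_map_pi fun j => (hR j).aemeasurable]
  exact (integral_map hRm.aemeasurable hyi.aestronglyMeasurable).symm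

/-- The contest reads off from the signal `s j` the interim allocation `V j (s j)` that it reveals,
`V` being the equilibrium utility, and then follows a rule whose interim allocation is the identity.
Capping at `maxProb` matters only for signals above every equilibrium signal. -/
theorem implementableByContest_of_map_eq {P : (Fin n → ℝ) → Fin n → ℝ} (hP : Measurable P)
    (hPX : ∀ θ, P θ ∈ M.allocations) (hR : ∀ i, Measurable (R i))
    (hmono : ∀ i, MonotoneOn (R i) (M.typeSpace i))
    (hR_mem : ∀ i, ∀ t ∈ M.typeSpace i, R i t ∈ Icc 0 M.maxProb)
    (hmap : ∀ i,
      (M.typeDist i).map (R i) = (M.typeDist i).map (interimAllocation M.typeDist P i)) :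
    M.ImplementableByContest R (M.contestUtility R) := by
  obtain ⟨y, hy, hyX, hy_interim⟩ := exists_interimAllocation_eq_self (μ := M.typeDist)
    M.isCompact_allocations M.convex_allocations zero_mem_allocations hP hPX
  have hbdd : ∀ i, BddBelow (R i '' M.typeSpace i) := fun i =>
    ⟨0, forall_mem_image.2 fun t ht => (hR_mem i t ht).1⟩
  let g : Fin n → ℝ≥0 → ℝ := fun j s => min M.maxProb (M.contestUtility R j s)
  have hg : ∀ j, Measurable (g j) := fun j => measurable_const.min
    ((monotone_contestUtility (hbdd j)).measurable.comp measurable_coe_nnreal_real)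
  have hg_signal : ∀ j, ∀ t ∈ M.typeSpace j, g j (M.contestSignal R j t) = R j t :=
    fun j t ht => by
      simp only [g, contestUtility_contestSignal (hbdd j) (hmono j) ht,
        min_eq_right (hR_mem j t ht).2]
  have hinterim : ∀ i s, ∫ θ, y (fun j =>
      g j (Function.update (fun j => M.contestSignal R j (θ j)) i s j)) i ∂M.profileDist = g i s :=
    fun i s => by
      rw [integral_eq_interimAllocation_of_comp_signal hy hR hg_signal, funext hmap]
      exact hy_interim i _ (single_mem_allocations
        ⟨le_min M.maxProb_nonneg (contestUtility_nonneg (fun t ht => (hR_mem i t ht).1) s),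
          min_le_left _ _⟩)
  refine ⟨fun s => y fun j => g j (s j), M.contestSignal R,
    hy.comp (measurable_pi_lambda _ fun j => (hg j).comp (measurable_pi_apply j)),
    fun s => hyX _, fun i => measurable_contestSignal (hbdd i) (hR i),
    fun i t ht => ?_, fun i t ht => ?_, fun i t _ s => ?_⟩
  · rw [hinterim, hg_signal i t ht]
  · rw [mul_effort_contestSignal (hbdd i) ht, sub_sub_cancel]
  · rw [hinterim, sub_le_iff_le_add]
    exact (min_le_right _ _).trans
      (lipschitzMinorant_le_add M.η_pos.le (hbdd i) (M.typeSpace_nonempty i) s t)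

end Contest

section Rearrangement

variable {P : (Fin n → ℝ) → Fin n → ℝ}

variable (M) in
/-- The nondecreasing rearrangement of the interim allocations induced by `P`. -/
noncomputable def rearrangedAllocation (P : (Fin n → ℝ) → Fin n → ℝ) (i : Fin n) : ℝ → ℝ :=
  monotoneTransport (M.typeDist i) ((M.typeDist i).map (interimAllocation M.typeDist P i))
    0 M.maxProb

lemma ae_map_interimAllocation_mem_Icc (hP : Measurable P) (hPX : ∀ θ, P θ ∈ M.allocations)
    (i : Fin n) :
    ∀ᵐ q ∂(M.typeDist i).map (interimAllocation M.typeDist P i), q ∈ Icc 0 M.maxProb :=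
  (ae_map_iff (measurable_interimAllocation hP i).aemeasurable measurableSet_Icc).2
    (ae_of_all _ (interimAllocation_mem_Icc hP hPX i))

lemma rearrangedAllocation_mem_Icc (hP : Measurable P) (hPX : ∀ θ, P θ ∈ M.allocations)
    (i : Fin n) (t : ℝ) : M.rearrangedAllocation P i t ∈ Icc 0 M.maxProb :=
  monotoneTransport_mem_Icc M.maxProb_nonneg (ae_map_interimAllocation_mem_Icc hP hPX i) t

lemma bddBelow_rearrangedAllocation (hP : Measurable P) (hPX : ∀ θ, P θ ∈ M.allocations)
    (i : Fin n) : BddBelow (M.rearrangedAllocation P i '' M.typeSpace i) :=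
  ⟨0, forall_mem_image.2 fun t _ => (rearrangedAllocation_mem_Icc hP hPX i t).1⟩

lemma monotone_rearrangedAllocation (hP : Measurable P) (hPX : ∀ θ, P θ ∈ M.allocations)
    (i : Fin n) : Monotone (M.rearrangedAllocation P i) :=
  monotone_monotoneTransport M.maxProb_nonneg (ae_map_interimAllocation_mem_Icc hP hPX i)

lemma map_rearrangedAllocation (hP : Measurable P) (hPX : ∀ θ, P θ ∈ M.allocations) (i : Fin n) :
    (M.typeDist i).map (M.rearrangedAllocation P i)
      = (M.typeDist i).map (interimAllocation M.typeDist P i) :=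
  have := Measure.isProbabilityMeasure_map (μ := M.typeDist i)
    (measurable_interimAllocation (μ := M.typeDist) hP i).aemeasurable
  map_monotoneTransport M.maxProb_nonneg (ae_map_interimAllocation_mem_Icc hP hPX i)

lemma implementableByContest_rearrangedAllocation (hP : Measurable P)
    (hPX : ∀ θ, P θ ∈ M.allocations) :
    M.ImplementableByContest (M.rearrangedAllocation P)
      (M.contestUtility (M.rearrangedAllocation P)) :=
  implementableByContest_of_map_eq hP hPX
    (fun i => (monotone_rearrangedAllocation hP hPX i).measurable)
    (fun i => (monotone_rearrangedAllocation hP hPX i).monotoneOn _)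
    (fun i t _ => rearrangedAllocation_mem_Icc hP hPX i t) (map_rearrangedAllocation hP hPX)

lemma ImplementableByGeneral.utility_le_contestUtility {Q U : Fin n → ℝ → ℝ}
    (h : M.ImplementableByGeneral Q U) (hP : Measurable P) (hPX : ∀ θ, P θ ∈ M.allocations)
    (hQ : ∀ i, ∀ t ∈ M.typeSpace i, Q i t = interimAllocation M.typeDist P i t) (i : Fin n) {t : ℝ}
    (ht : t ∈ M.typeSpace i) : U i t ≤ M.contestUtility (M.rearrangedAllocation P) i t :=
  le_lipschitzMinorant
    (fun _ hs => le_monotoneTransport_map (M.ae_mem_typeSpace i) (measurable_interimAllocation hP i)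
      (interimAllocation_mem_Icc hP hPX i) (h.monotoneOn_utility i)
      (fun r hr => (h.utility_le_allocation i hr).trans_eq (hQ i r hr)) hs)
    (M.typeSpace_nonempty i) fun _ hs => h.utility_le_add i ht hs

lemma identDistrib_rearrangedAllocation {Q : Fin n → ℝ → ℝ} (hP : Measurable P)
    (hPX : ∀ θ, P θ ∈ M.allocations)
    (hQ : ∀ i, ∀ t ∈ M.typeSpace i, Q i t = interimAllocation M.typeDist P i t) (i : Fin n) :
    IdentDistrib (Q i) (M.rearrangedAllocation P i) (M.typeDist i) (M.typeDist i) := by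
  have hint : AEMeasurable (interimAllocation M.typeDist P i) (M.typeDist i) :=
    (measurable_interimAllocation hP i).aemeasurable
  have hae : interimAllocation M.typeDist P i =ᵐ[M.typeDist i] Q i :=
    (M.ae_mem_typeSpace i).mono fun t ht => (hQ i t ht).symm
  exact (IdentDistrib.of_ae_eq hint hae).symm.trans
    ⟨hint, (monotone_rearrangedAllocation hP hPX i).measurable.aemeasurable,
      (map_rearrangedAllocation hP hPX i).symm⟩

end Rearrangement

section Objective

variable {Q Q' U U' : Fin n → ℝ → ℝ}

lemma integrable_id_mul {i : Fin n} {g : ℝ → ℝ} (hg : Integrable g (M.typeDist i)) :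
    Integrable (fun t => t * g t) (M.typeDist i) :=
  hg.bdd_mul (c := max |M.lo i| |M.hi i|) aestronglyMeasurable_id
    ((M.ae_mem_typeSpace i).mono fun _ ht => abs_le_max_abs_abs ht.1 ht.2)

lemma integrable_sum_eval {g : Fin n → ℝ → ℝ} (hg : ∀ i, Integrable (g i) (M.typeDist i)) :
    Integrable (fun θ => ∑ i, g i (θ i)) M.profileDist :=
  integrable_finsetSum _ fun i _ => integrable_comp_eval (hg i)

lemma integral_sum_eval {g : Fin n → ℝ → ℝ} (hg : ∀ i, Integrable (g i) (M.typeDist i)) :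
    ∫ θ, ∑ i, g i (θ i) ∂M.profileDist = ∑ i, ∫ t, g i t ∂M.typeDist i := by
  rw [profileDist, integral_finsetSum _ fun i _ => integrable_comp_eval (hg i)]
  exact Finset.sum_congr rfl fun i _ => integral_comp_eval (hg i).aestronglyMeasurable

lemma matchingEfficiency_le_of_identDistrib (hQ' : ∀ i, Monotone (Q' i))
    (hQQ' : ∀ i, IdentDistrib (Q i) (Q' i) (M.typeDist i) (M.typeDist i)) :
    M.matchingEfficiency Q ≤ M.matchingEfficiency Q' := by
  have hQ'_int : ∀ i, Integrable (Q' i) (M.typeDist i) := fun i =>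
    integrable_of_monotoneOn ((hQ' i).monotoneOn _)
  rw [matchingEfficiency, matchingEfficiency,
    integral_sum_eval fun i => integrable_id_mul ((hQQ' i).integrable_iff.2 (hQ'_int i)),
    integral_sum_eval fun i => integrable_id_mul (hQ'_int i)]
  exact Finset.sum_le_sum fun i _ => integral_mul_le_integral_mul_comp_of_monotone aemeasurable_id
    (M.ae_mem_typeSpace i) (hQ' i) (hQQ' i)

lemma objective_eq (α : ℝ) (hQ : ∀ i, Integrable (Q i) (M.typeDist i))
    (hU : ∀ i, Integrable (U i) (M.typeDist i)) :
    M.objective α Q U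
      = α * M.matchingEfficiency Q + (1 - α) * ∑ i, ∫ t, U i t ∂M.typeDist i := by
  rw [objective, matchingEfficiency, integral_add
      ((integrable_sum_eval fun i => integrable_id_mul (hQ i)).const_mul α)
      ((integrable_sum_eval hU).const_mul (1 - α)),
    integral_const_mul, integral_const_mul, integral_sum_eval hU]

lemma objective_le_objective {α : ℝ} (hα : α ∈ Icc 0 1)
    (hQ : ∀ i, Integrable (Q i) (M.typeDist i)) (hQ' : ∀ i, Integrable (Q' i) (M.typeDist i))
    (hU : ∀ i, Integrable (U i) (M.typeDist i)) (hU' : ∀ i, Integrable (U' i) (M.typeDist i))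
    (heff : M.matchingEfficiency Q ≤ M.matchingEfficiency Q')
    (hUU' : ∀ i, ∀ t ∈ M.typeSpace i, U i t ≤ U' i t) :
    M.objective α Q U ≤ M.objective α Q' U' := by
  rw [objective_eq α hQ hU, objective_eq α hQ' hU']
  refine add_le_add (mul_le_mul_of_nonneg_left heff hα.1)
    (mul_le_mul_of_nonneg_left (Finset.sum_le_sum fun i _ => ?_) (sub_nonneg.2 hα.2))
  exact integral_mono_ae (hU i) (hU' i) ((M.ae_mem_typeSpace i).mono (hUU' i))

end Objective

end ContestModel

theorem mainTheorem1 {n : ℕ} (M : ContestModel n) (Q U : Fin n → ℝ → ℝ)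
    (h : M.ImplementableByGeneral Q U) :
    ∃ Q' U' : Fin n → ℝ → ℝ,
      (∀ i, MonotoneOn (Q' i) (M.typeSpace i)) ∧
      M.ImplementableByContest Q' U' ∧
      M.matchingEfficiency Q ≤ M.matchingEfficiency Q' ∧
      (∀ i, ∀ t ∈ M.typeSpace i, U i t ≤ U' i t) ∧
      ∀ α ∈ Set.Icc (0 : ℝ) 1, M.objective α Q U ≤ M.objective α Q' U' := by
  obtain ⟨P, hP, hPX, hQ⟩ := h.exists_eq_interimAllocation
  let R := M.rearrangedAllocation P
  have hR : ∀ i, Monotone (R i) := ContestModel.monotone_rearrangedAllocation hP hPX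
  have hcontest : M.ImplementableByContest R (M.contestUtility R) :=
    ContestModel.implementableByContest_rearrangedAllocation hP hPX
  have hQR : ∀ i, IdentDistrib (Q i) (R i) (M.typeDist i) (M.typeDist i) :=
    ContestModel.identDistrib_rearrangedAllocation hP hPX hQ
  have heff : M.matchingEfficiency Q ≤ M.matchingEfficiency R :=
    ContestModel.matchingEfficiency_le_of_identDistrib hR hQR
  have hUV : ∀ i, ∀ t ∈ M.typeSpace i, U i t ≤ M.contestUtility R i t := fun i t ht =>
    h.utility_le_contestUtility hP hPX hQ i ht
  refine ⟨R, M.contestUtility R, fun i => (hR i).monotoneOn _, hcontest, heff, hUV, fun α hα => ?_⟩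
  have hR_int : ∀ i, Integrable (R i) (M.typeDist i) := fun i =>
    ContestModel.integrable_of_monotoneOn ((hR i).monotoneOn _)
  exact ContestModel.objective_le_objective hα (fun i => (hQR i).integrable_iff.2 (hR_int i)) hR_int
    (fun i => ContestModel.integrable_of_monotoneOn (h.monotoneOn_utility i))
    (fun i => ContestModel.integrable_contestUtility
      (ContestModel.bddBelow_rearrangedAllocation hP hPX i)) heff hUV
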